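/- All graphs are finite, simple and connected. A block of a graph is a maximal connected subgraph without a cut vertex; a block graph is a connected graph all of whose blocks are cliques. For a graph $G$ of order $n$ let $D(u,v)$ be the length of a longest path between $u$ and $v$; the detour eccentricity of $v$ is $\max_u D(v,u)$; the detour center $C_D(G)$ is the set of vertices of minimum detour eccentricity, and $\omega(G)=|C_D(G)|$. Put $\mathcal L(u)=\min\{D(w,u): w\in C_D(G)\}$ and $\mathcal L(G)=\sum_{u\in V(G)}\mathcal L(u)$. If $\omega(G)=1$, let $\xi(G)$ be the minimum of $|V(B)|-1$ over the blocks $B$ containing the detour central vertex; otherwise $\xi(G)=0$. A hamiltonian coloring of $G$ is a map $c:V(G)\to\{0,1,2,\dots\}$ with $D(u,v)+|c(u)-c(v)|\ge n-1$ for all distinct $u,v$, and $hc(G)$ is the minimum over all hamiltonian colorings $c$ of $\max_v c(v)$. Say that $G$ satisfies condition $(*)$ if its vertices can be ordered $u_0,u_1,\dots,u_{n-1}$ with $\mathcal L(u_0)=0$, $\mathcal L(u_{n-1})=\xi(G)$ and $$D(u_i,u_j)\ \ge\ \sum_{t=i}^{j-1}\bigl(\mathcal L(u_t)+\mathcal L(u_{t+1})\bigr)-(j-i)(n-\omega(G))+(n-1)\qquad(0\le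 i<j\le n-1).$$ Theorem. Let $k\ge 1$ and let $G_1,\dots,G_k$ be block graphs of orders $n_1,\dots,n_k\ge 2$, with $C_D(G_i)=\{w_i\}$, each satisfying $(*)$; write $\xi_i=\xi(G_i)$. Let $G_k(w)$ be the graph of order $n$ obtained from the disjoint union of the $G_i$ by identifying $w_1,\dots,w_k$ to a single vertex $w$, and let $\xi=\xi(G_k(w))$. Then $G_k(w)$ is a block graph, $C_D(G_k(w))=\{w\}$, $\xi=\min_i\xi_i$, $G_k(w)$ satisfies $(*)$, $hc(G_k(w))=(n-1)(n-\omega(G_k(w)))-2\mathcal L(G_k(w))+\xi$, and $$hc(G_k(w))=\sum_{i=1}^{k}\bigl(hc(G_i)-\xi_i\bigr)+2\sum_{1\le i<j\le k}(n_i-1)(n_j-1)+\xi .$$ -/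

import Mathlib

namespace SimpleGraph

section Detour

variable {V : Type*}

/-- `v` is a cut vertex: deleting `v` disconnects some two other vertices of one component, that is,
increases the number of components. -/
def IsCutVertex (G : SimpleGraph V) (v : V) : Prop :=
  ∃ (a b : V) (ha : a ∈ ({v}ᶜ : Set V)) (hb : b ∈ ({v}ᶜ : Set V)),
    G.Reachable a b ∧ ¬ (G.induce ({v}ᶜ : Set V)).Reachable ⟨a, ha⟩ ⟨b, hb⟩

/-- A block is a maximal connected subgraph that has no cut vertex (of its own). -/
def IsBlock (G : SimpleGraph V) (B : G.Subgraph) : Prop :=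
  Maximal (fun H : G.Subgraph => H.Connected ∧ ∀ v : H.verts, ¬ H.coe.IsCutVertex v) B

/-- A block graph is a connected graph all of whose blocks are cliques. -/
def IsBlockGraph (G : SimpleGraph V) : Prop :=
  G.Connected ∧ ∀ B : G.Subgraph, G.IsBlock B → B.verts.Pairwise B.Adj

/-- The detour distance `D(u, v)`: the length of a longest path between `u` and `v`. -/
noncomputable def detourDist (G : SimpleGraph V) (u v : V) : ℕ :=
  sSup {m : ℕ | ∃ p : G.Walk u v, p.IsPath ∧ p.length = m}

variable [Fintype V]

/-- The detour eccentricity of `v`: the largest detour distance from `v`. -/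
noncomputable def detourEcc (G : SimpleGraph V) (v : V) : ℕ :=
  Finset.univ.sup fun u => G.detourDist v u

/-- The (vertex set of the) detour center: the vertices of minimum detour eccentricity. -/
def detourCenter (G : SimpleGraph V) : Set V :=
  {v | ∀ u, G.detourEcc v ≤ G.detourEcc u}

/-- `ω`, the number of detour central vertices. -/
noncomputable def detourOmega (G : SimpleGraph V) : ℕ :=
  G.detourCenter.ncard

/-- The detour level of `u`: the least detour distance from a detour central vertex to `u`. -/
noncomputable def detourLevel (G : SimpleGraph V) (u : V) : ℕ :=
  sInf ((fun w => G.detourDist w u) '' G.detourCenter)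

/-- The total detour level of the graph. -/
noncomputable def totalDetourLevel (G : SimpleGraph V) : ℕ :=
  ∑ u, G.detourLevel u

open Classical in
/-- `ξ`: if `ω = 1`, the minimum of `|V(B)| - 1` over the blocks `B` that contain the detour central
vertex; otherwise `0`. -/
noncomputable def detourXi (G : SimpleGraph V) : ℕ :=
  if G.detourOmega = 1 then
    sInf {m : ℕ | ∃ B : G.Subgraph, G.IsBlock B ∧ (B.verts ∩ G.detourCenter).Nonempty ∧
      B.verts.ncard - 1 = m}
  else 0

/-- Hamiltonian colorings: `D(u, v) + |c(u) - c(v)| ≥ n - 1` for all distinct `u`, `v`. -/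
def IsHamiltonianColoring (G : SimpleGraph V) (c : V → ℕ) : Prop :=
  ∀ u v : V, u ≠ v →
    (G.detourDist u v : ℤ) + |(c u : ℤ) - (c v : ℤ)| ≥ (Fintype.card V : ℤ) - 1

/-- The hamiltonian chromatic number: the least possible maximum color of a hamiltonian coloring. -/
noncomputable def hamiltonianChromaticNumber (G : SimpleGraph V) : ℕ :=
  sInf {m : ℕ | ∃ c : V → ℕ, G.IsHamiltonianColoring c ∧ Finset.univ.sup c = m}

/-- The ordering condition, with `n = |V|`: the vertices can be listed as `u 0, …, u (n - 1)`, each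
exactly once (the values of `u` from `n` on play no role), such that `u 0` has level `0`,
`u (n - 1)` has level `ξ` (which is `0` if `ω ≥ 2`), and
`D(u i, u j) ≥ ∑_{i ≤ t < j} (L(u t) + L(u (t + 1))) - (j - i) (n - ω) + (n - 1)` for `i < j`. -/
def HasDetourOrdering (G : SimpleGraph V) : Prop :=
  ∃ u : ℕ → V, Set.BijOn u (Set.Iio (Fintype.card V)) Set.univ ∧
    G.detourLevel (u 0) = 0 ∧ G.detourLevel (u (Fintype.card V - 1)) = G.detourXi ∧
    ∀ i j : ℕ, i < j → j < Fintype.card V →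
      (G.detourDist (u i) (u j) : ℤ) ≥
        ∑ t ∈ Finset.Ico i j, ((G.detourLevel (u t) : ℤ) + (G.detourLevel (u (t + 1)) : ℤ))
          - ((j : ℤ) - (i : ℤ)) * ((Fintype.card V : ℤ) - (G.detourOmega : ℤ))
          + ((Fintype.card V : ℤ) - 1)

end Detour

section Glue

variable {ι : Type*} {V : ι → Type*}

/-- The equivalence relation on the disjoint union that identifies all the base points `w i`. -/
def glueSetoid (w : ∀ i, V i) : Setoid (Σ i, V i) where
  r x y := x = y ∨ (x.2 = w x.1 ∧ y.2 = w y.1)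
  iseqv :=
    { refl := fun _ => Or.inl rfl
      symm := by
        rintro x y (h | ⟨h, h'⟩)
        · exact Or.inl h.symm
        · exact Or.inr ⟨h', h⟩
      trans := by
        rintro x y z (rfl | ⟨h, h'⟩) (rfl | ⟨k, k'⟩)
        · exact Or.inl rfl
        · exact Or.inr ⟨k, k'⟩
        · exact Or.inr ⟨h, h'⟩
        · exact Or.inr ⟨h, k'⟩ }

/-- The disjoint union of the vertex sets with all the base points `w i` identified. -/
def GlueVertex (w : ∀ i, V i) : Type _ := Quotient (glueSetoid w)

noncomputable instance [Finite ι] [∀ i, Finite (V i)] (w : ∀ i, V i) : Fintype (GlueVertex w) :=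
  have : Finite (GlueVertex w) := Quotient.finite (glueSetoid w)
  Fintype.ofFinite _

/-- The vertex of the glued graph that comes from the vertex `a` of the `i`-th graph. -/
def glueMk (w : ∀ i, V i) (i : ι) (a : V i) : GlueVertex w :=
  Quotient.mk (glueSetoid w) ⟨i, a⟩

theorem glueMk_injective (w : ∀ i, V i) (i : ι) : Function.Injective (glueMk w i) := by
  intro a b h
  rcases Quotient.exact h with h | ⟨h, h'⟩
  · exact eq_of_heq (Sigma.mk.inj h).2
  · exact h.trans h'.symm

/-- The graph obtained from the disjoint union of the graphs `G i` by identifying all the vertices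
`w i` to a single vertex. -/
def glue (G : ∀ i, SimpleGraph (V i)) (w : ∀ i, V i) : SimpleGraph (GlueVertex w) where
  Adj x y := ∃ (i : ι) (a b : V i), (G i).Adj a b ∧ x = glueMk w i a ∧ y = glueMk w i b
  symm := ⟨by
    rintro x y ⟨i, a, b, h, hx, hy⟩
    exact ⟨i, b, a, h.symm, hy, hx⟩⟩
  loopless := ⟨by
    rintro x ⟨i, a, b, h, hx, hy⟩
    exact h.ne (glueMk_injective w i (hx.symm.trans hy))⟩

end Glue

end SimpleGraph

/-! Gluing at `w` makes `w` separate the parts. A path between two vertices of one part cannot leave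
it, since it would have to pass `w` twice; a path between different parts passes `w`. Hence detour
distances inside a part are unchanged and those between parts add up through `w`
(`detourDist_glueMk_same`, `detourDist_glueMk_of_ne`). It follows that `w` is the only detour
central vertex and that levels are preserved. A connected subgraph meeting two parts off `w` has `w`
as a cut vertex, so the blocks are the images of the blocks of the parts; this gives the block graph
property and `ξ`.

For `ω = 1`, condition `(*)` is equivalent to `L(x) + L(y) ≤ D(x,y) + ∑ (n - 1 - 2 L(z))`, summed
over the `z` strictly between `x` and `y`. All summands are nonnegative, because `(*)` forces `2
L(z) ≤ n - 1` (`two_mul_detourLevel_lt_card`). So one may list `w` first and then the remaining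
vertices part by part, with a part of least `ξ` last: across parts `D = L + L`, and inside a part
gluing only adds nonnegative summands and enlarges the old ones (`isDetourRank_glueRank`).

The value of `hc` comes from telescoping. Sorted by color, consecutive colors differ by at least `n
- 1 - L(u t) - L(u (t + 1))`, because `D ≤ L + L`; the end terms contribute at least `ξ`. Under
`(*)`, the partial sums of these gaps are a hamiltonian coloring attaining the bound
(`hamiltonianChromaticNumber_eq`). The last formula expands `(n - 1)²` with `n - 1 = ∑ (n_i - 1)`.
-/

namespace SimpleGraph

/-! ### Paths and the detour metric. -/

section DetourDistance

variable {V : Type*} {G : SimpleGraph V}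

theorem Walk.IsPath.append_of_support_inter {u v w : V} {p : G.Walk u v} {q : G.Walk v w}
    (hp : p.IsPath) (hq : q.IsPath) (h : ∀ x ∈ p.support, x ∈ q.support → x = v) :
    (p.append q).IsPath := by
  rw [Walk.isPath_def, Walk.support_append]
  have hq' := hq.support_nodup
  rw [← Walk.cons_tail_support, List.nodup_cons] at hq'
  refine List.Nodup.append hp.support_nodup hq'.2 ?_
  intro x hx hx'
  have := h x hx (List.mem_of_mem_tail hx')
  subst this
  exact hq'.1 hx'

theorem Walk.IsPath.exists_isPath_first_mem {a b : V} {q : G.Walk a b} (hq : q.IsPath)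
    (S : Set V) (hb : b ∈ S) :
    ∃ c ∈ S, ∃ q' : G.Walk a c, q'.IsPath ∧ q'.support ⊆ q.support ∧
      ∀ x ∈ q'.support, x ∈ S → x = c := by
  induction q with
  | nil => exact ⟨_, hb, Walk.nil, by simp, by simp, by simp⟩
  | @cons a x b h q ih =>
    by_cases ha : a ∈ S
    · exact ⟨a, ha, Walk.nil, by simp, by simp, by simp⟩
    · rw [Walk.cons_isPath_iff] at hq
      obtain ⟨c, hc, q', hq', hsub, hS⟩ := ih hq.1 hb
      refine ⟨c, hc, Walk.cons h q', ?_, ?_, ?_⟩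
      · exact hq'.cons fun h' => hq.2 (hsub h')
      · intro y hy
        simp only [Walk.support_cons, List.mem_cons] at hy ⊢
        exact hy.imp_right fun h' => hsub h'
      · intro y hy hyS
        simp only [Walk.support_cons, List.mem_cons] at hy
        rcases hy with rfl | hy
        · exact absurd hyS ha
        · exact hS y hy hyS

theorem exists_isPath_of_pairwise_adj (S : Finset V) (hS : (S : Set V).Pairwise G.Adj) {a b : V}
    (ha : a ∈ S) (hb : b ∈ S) (hab : a ≠ b) :
    ∃ p : G.Walk a b, p.IsPath ∧ p.length = S.card - 1 ∧ ∀ x ∈ p.support, x ∈ S := by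
  classical
  induction hn : S.card generalizing S a with
  | zero => simp [Finset.card_eq_zero.mp hn] at ha
  | succ n ih =>
    have hbe : b ∈ S.erase a := Finset.mem_erase.mpr ⟨hab.symm, hb⟩
    have hce : (S.erase a).card = n := by rw [Finset.card_erase_of_mem ha, hn]; rfl
    by_cases hc : ∃ c ∈ S.erase a, c ≠ b
    · obtain ⟨c, hc, hcb⟩ := hc
      obtain ⟨p, hp, hlen, hsup⟩ := ih (S.erase a)
        (hS.mono (by simp)) hc hbe hcb hce
      have hcS := Finset.mem_erase.mp hc
      refine ⟨Walk.cons (hS ha hcS.2 hcS.1.symm) p, ?_, ?_, ?_⟩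
      · exact hp.cons fun h => (Finset.mem_erase.mp (hsup a h)).1 rfl
      · have : 0 < n := by rw [← hce]; exact Finset.card_pos.mpr ⟨b, hbe⟩
        simp only [Walk.length_cons, hlen]
        omega
      · intro x hx
        simp only [Walk.support_cons, List.mem_cons] at hx
        rcases hx with rfl | hx
        · exact ha
        · exact (Finset.mem_erase.mp (hsup x hx)).2
    · push Not at hc
      have : S.erase a = {b} := by
        ext x
        exact ⟨fun hx => by simp [hc x hx], fun hx => by rw [Finset.mem_singleton.mp hx]; exact hbe⟩
      have hn1 : n = 1 := by rw [← hce, this]; simp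
      subst hn1
      refine ⟨(hS ha hb hab).toWalk, (hS ha hb hab).isPath_toWalk, by simp, ?_⟩
      simp [ha, hb]

theorem detourDist_self (u : V) : G.detourDist u u = 0 := by
  have : {m : ℕ | ∃ p : G.Walk u u, p.IsPath ∧ p.length = m} = {0} := by
    ext m
    constructor
    · rintro ⟨p, hp, rfl⟩
      exact (Walk.isPath_iff_nil.mp hp).length_eq_zero
    · rintro rfl
      exact ⟨Walk.nil, by simp, rfl⟩
  rw [detourDist, this, csSup_singleton]

theorem detourDist_comm (u v : V) : G.detourDist u v = G.detourDist v u := by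
  unfold detourDist
  congr 1
  ext m
  constructor <;>
  · rintro ⟨p, hp, rfl⟩
    exact ⟨p.reverse, hp.reverse, by simp⟩

theorem Walk.IsPath.length_lt_card [Finite V] {u v : V} {p : G.Walk u v} (hp : p.IsPath) :
    p.length < Nat.card V := by
  have := Fintype.ofFinite V
  rw [Nat.card_eq_fintype_card]
  exact hp.length_lt

theorem Walk.IsPath.length_le_detourDist [Finite V] {u v : V} {p : G.Walk u v} (hp : p.IsPath) :
    p.length ≤ G.detourDist u v := by
  refine le_csSup ⟨Nat.card V, ?_⟩ ⟨p, hp, rfl⟩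
  rintro m ⟨q, hq, rfl⟩
  exact hq.length_lt_card.le

theorem Reachable.exists_isPath_length_eq_detourDist [Finite V] {u v : V} (h : G.Reachable u v) :
    ∃ p : G.Walk u v, p.IsPath ∧ p.length = G.detourDist u v := by
  classical
  refine Nat.sSup_mem (s := {m : ℕ | ∃ p : G.Walk u v, p.IsPath ∧ p.length = m}) ?_
    ⟨Nat.card V, ?_⟩
  · obtain ⟨p⟩ := h
    exact ⟨_, p.bypass, p.bypass_isPath, rfl⟩
  · rintro m ⟨q, hq, rfl⟩
    exact hq.length_lt_card.le

theorem Connected.exists_isPath_length_eq_detourDist [Finite V] (hG : G.Connected) (u v : V) :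
    ∃ p : G.Walk u v, p.IsPath ∧ p.length = G.detourDist u v :=
  (hG.preconnected u v).exists_isPath_length_eq_detourDist

theorem Connected.detourDist_lt_card [Fintype V] (hG : G.Connected) (u v : V) :
    G.detourDist u v < Fintype.card V := by
  obtain ⟨p, hp, h⟩ := hG.exists_isPath_length_eq_detourDist u v
  exact h ▸ hp.length_lt

theorem Connected.detourDist_eq_zero_iff [Finite V] (hG : G.Connected) {u v : V} :
    G.detourDist u v = 0 ↔ u = v := by
  constructor
  · intro h
    obtain ⟨p, -, hp⟩ := hG.exists_isPath_length_eq_detourDist u v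
    exact Walk.eq_of_length_eq_zero (hp.trans h)
  · rintro rfl
    exact detourDist_self u

/-- Attach to a longest `u`-`v` path `p` a path `r` from `w` to the first vertex `c` of `p` that it
meets. Both `u`-`c`-`w` and `w`-`c`-`v` are then paths, of total length `|p| + 2|r|`. -/
theorem Connected.detourDist_triangle [Finite V] (hG : G.Connected) (u w v : V) :
    G.detourDist u v ≤ G.detourDist u w + G.detourDist w v := by
  classical
  obtain ⟨p, hp, hlen⟩ := hG.exists_isPath_length_eq_detourDist u v
  obtain ⟨q, hq, -⟩ := hG.exists_isPath_length_eq_detourDist w u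
  obtain ⟨c, hc, r, hr, -, hS⟩ := hq.exists_isPath_first_mem {x | x ∈ p.support} (by simp)
  replace hc : c ∈ p.support := hc
  have h1 : ((p.takeUntil c hc).append r.reverse).IsPath :=
    (hp.takeUntil hc).append_of_support_inter hr.reverse fun x hx hx' =>
      hS x (by simpa using hx') (p.support_takeUntil_subset_support hc hx)
  have h2 : (r.append (p.dropUntil c hc)).IsPath :=
    hr.append_of_support_inter (hp.dropUntil hc) fun x hx hx' =>
      hS x hx (p.support_dropUntil_subset_support hc hx')
  have h1' := h1.length_le_detourDist
  have h2' := h2.length_le_detourDist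
  have h3 := congrArg Walk.length (p.take_spec hc)
  simp only [Walk.length_append, Walk.length_reverse] at h1' h2' h3
  omega

end DetourDistance

/-! ### Eccentricity and level when the detour center is one vertex. -/

section DetourCenter

variable {V : Type*} [Fintype V] {G : SimpleGraph V}

theorem detourDist_le_detourEcc (u v : V) : G.detourDist u v ≤ G.detourEcc u :=
  Finset.le_sup (f := fun v => G.detourDist u v) (Finset.mem_univ v)

theorem exists_detourDist_eq_detourEcc (u : V) : ∃ v, G.detourDist u v = G.detourEcc u := by
  obtain ⟨v, -, hv⟩ := Finset.exists_mem_eq_sup Finset.univ ⟨u, Finset.mem_univ u⟩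
    fun v => G.detourDist u v
  exact ⟨v, hv.symm⟩

theorem detourEcc_lt_of_detourCenter_eq {w : V} (h : G.detourCenter = {w}) {u : V} (hu : u ≠ w) :
    G.detourEcc w < G.detourEcc u := by
  have hw : ∀ v, G.detourEcc w ≤ G.detourEcc v := by
    have : w ∈ G.detourCenter := by simp [h]
    exact this
  refine lt_of_not_ge fun hle => hu ?_
  have : u ∈ G.detourCenter := fun v => hle.trans (hw v)
  simpa [h] using this

theorem detourCenter_eq_singleton {w : V} (h : ∀ u, u ≠ w → G.detourEcc w < G.detourEcc u) :
    G.detourCenter = {w} := by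
  ext u
  constructor
  · intro hu
    by_contra hne
    exact absurd (hu w) (not_le.mpr (h u hne))
  · rintro rfl v
    by_cases hv : v = u
    · rw [hv]
    · exact (h v hv).le

theorem detourLevel_eq {w : V} (h : G.detourCenter = {w}) (u : V) :
    G.detourLevel u = G.detourDist w u := by
  simp [detourLevel, h]

theorem detourOmega_eq_one {w : V} (h : G.detourCenter = {w}) : G.detourOmega = 1 := by
  simp [detourOmega, h]

theorem detourXi_eq {w : V} (h : G.detourCenter = {w}) :
    G.detourXi = sInf {m : ℕ | ∃ B : G.Subgraph, G.IsBlock B ∧ w ∈ B.verts ∧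
      B.verts.ncard - 1 = m} := by
  rw [detourXi, if_pos (detourOmega_eq_one h), h]
  simp

end DetourCenter

/-! ### Blocks at the central vertex and the bound `ξ ≤ L(u)`. -/

section Blocks

variable {V : Type*} {G : SimpleGraph V}

theorem not_isCutVertex_subgraphOfAdj {a b : V} (h : G.Adj a b) (v : (G.subgraphOfAdj h).verts) :
    ¬ (G.subgraphOfAdj h).coe.IsCutVertex v := by
  rintro ⟨x, y, hx, hy, -, hxy⟩
  apply hxy
  have : x = y := by
    obtain ⟨x, hx'⟩ := x
    obtain ⟨y, hy'⟩ := y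
    obtain ⟨v, hv'⟩ := v
    simp only [subgraphOfAdj_verts, Set.mem_insert_iff, Set.mem_singleton_iff] at hx' hy' hv'
    simp only [Set.mem_compl_iff, Set.mem_singleton_iff, Subtype.mk.injEq] at hx hy ⊢
    grind
  subst this
  exact Reachable.refl _

theorem exists_isBlock_of_adj [Finite V] {a b : V} (h : G.Adj a b) :
    ∃ B : G.Subgraph, G.IsBlock B ∧ a ∈ B.verts ∧ b ∈ B.verts := by
  obtain ⟨B, hle, hB⟩ := Finite.exists_le_maximal
    (p := fun H : G.Subgraph => H.Connected ∧ ∀ v : H.verts, ¬ H.coe.IsCutVertex v)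
    (a := G.subgraphOfAdj h)
    ⟨Subgraph.subgraphOfAdj_connected h, not_isCutVertex_subgraphOfAdj h⟩
  exact ⟨B, hB, hle.1 (by simp), hle.1 (by simp)⟩

theorem Connected.exists_isBlock_mem [Finite V] [Nontrivial V] (hG : G.Connected) (w : V) :
    ∃ B : G.Subgraph, G.IsBlock B ∧ w ∈ B.verts := by
  obtain ⟨x, hx⟩ := hG.preconnected.exists_adj_of_nontrivial w
  obtain ⟨B, hB, hw, -⟩ := exists_isBlock_of_adj hx
  exact ⟨B, hB, hw⟩

/-- A single vertex is never maximal, since any edge at it is a larger nonseparable subgraph. -/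
theorem IsBlock.exists_ne_mem [Nontrivial V] (hG : G.Connected) {B : G.Subgraph}
    (hB : G.IsBlock B) (w : V) : ∃ x ∈ B.verts, x ≠ w := by
  by_contra! h
  obtain ⟨y, hwy⟩ := hG.preconnected.exists_adj_of_nontrivial w
  have hle : B ≤ G.subgraphOfAdj hwy := by
    refine ⟨fun x hx => by simp [h x hx], fun x z hxz => ?_⟩
    exact absurd ((h x hxz.fst_mem).trans (h z hxz.snd_mem).symm) hxz.ne
  have hge := hB.2 ⟨Subgraph.subgraphOfAdj_connected hwy, not_isCutVertex_subgraphOfAdj hwy⟩ hle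
  exact hwy.ne (h y (hge.1 (by simp))).symm

variable [Fintype V]

/-- Take the block `B` of the first edge of a path from `w` to `u`. Walking back from `u`, let `y`
be the first vertex in `B`; it is not `w`. A path from `w` to `y` through the whole clique `B`,
continued to `u`, has length at least `|B| - 1`. -/
theorem IsBlockGraph.exists_isBlock_le_detourDist (hG : G.IsBlockGraph) {w u : V} (hu : u ≠ w) :
    ∃ B : G.Subgraph, G.IsBlock B ∧ w ∈ B.verts ∧ B.verts.ncard - 1 ≤ G.detourDist w u := by
  classical
  obtain ⟨p, hp, -⟩ := hG.1.exists_isPath_length_eq_detourDist w u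
  cases p with
  | nil => exact absurd rfl hu
  | @cons _ x _ hwx p =>
    obtain ⟨B, hB, hw, hx⟩ := exists_isBlock_of_adj hwx
    refine ⟨B, hB, hw, ?_⟩
    rw [Walk.cons_isPath_iff] at hp
    obtain ⟨y, hy, q, hq, hsub, hS⟩ := hp.1.reverse.exists_isPath_first_mem B.verts hx
    have hyw : y ≠ w := by
      rintro rfl
      exact hp.2 (by simpa using hsub q.end_mem_support)
    obtain ⟨r, hr, hlen, hrS⟩ := exists_isPath_of_pairwise_adj (G := G) B.verts.toFinset
      (by simpa using (hG.2 B hB).imp fun _ _ h => h.adj_sub) (by simpa using hw)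
      (by simpa using hy) hyw.symm
    have := (hr.append_of_support_inter hq.reverse fun z hz hz' =>
      hS z (by simpa using hz') (by simpa using hrS z hz)).length_le_detourDist
    rw [Walk.length_append, hlen, ← Set.ncard_eq_toFinset_card'] at this
    omega

theorem IsBlockGraph.detourXi_le_detourDist (hG : G.IsBlockGraph) {w : V}
    (hw : G.detourCenter = {w}) {u : V} (hu : u ≠ w) : G.detourXi ≤ G.detourDist w u := by
  obtain ⟨B, hB, hwB, hle⟩ := hG.exists_isBlock_le_detourDist hu
  rw [detourXi_eq hw]
  exact le_trans (Nat.sInf_le ⟨B, hB, hwB, rfl⟩) hle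

end Blocks

theorem Embedding.exists_walk_map_eq {V V' : Type*} {G : SimpleGraph V} {G' : SimpleGraph V'}
    (f : G ↪g G') {x y : V'} (p : G'.Walk x y) (hp : ∀ z ∈ p.support, z ∈ Set.range f) :
    ∀ a b, ∀ (ha : f a = x) (hb : f b = y),
      ∃ q : G.Walk a b, q.map f.toHom = p.copy ha.symm hb.symm := by
  induction p with
  | nil =>
    intro a b ha hb
    obtain rfl : a = b := f.injective (ha.trans hb.symm)
    subst ha
    exact ⟨Walk.nil, rfl⟩
  | @cons x z y h p ih =>
    intro a b ha hb
    obtain ⟨c, hc⟩ := hp z (by simp)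
    obtain ⟨q, hq⟩ := ih (fun v hv => hp v (by simp [hv])) c b hc hb
    subst ha hb hc
    exact ⟨Walk.cons (f.map_adj_iff.mp h) q, by simpa using hq⟩

/-! ### Detour distances in the glued graph. -/

section Glue

variable {ι : Type*} {V : ι → Type*} {w : ∀ i, V i} {G : ∀ i, SimpleGraph (V i)}

theorem glueMk_eq_glueMk_iff {i j : ι} {a : V i} {b : V j} :
    glueMk w i a = glueMk w j b ↔ (⟨i, a⟩ : Σ i, V i) = ⟨j, b⟩ ∨ (a = w i ∧ b = w j) :=
  Quotient.eq (r := glueSetoid w)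

theorem glueMk_base (i j : ι) : glueMk w i (w i) = glueMk w j (w j) :=
  glueMk_eq_glueMk_iff.mpr (Or.inr ⟨rfl, rfl⟩)

theorem glueMk_eq_base_iff {i j : ι} {a : V i} : glueMk w i a = glueMk w j (w j) ↔ a = w i := by
  rw [glueMk_base j i]
  exact (glueMk_injective w i).eq_iff

theorem exists_eq_glueMk (x : GlueVertex w) : ∃ i a, x = glueMk w i a := by
  induction x using Quotient.inductionOn with
  | h x => exact ⟨x.1, x.2, rfl⟩

theorem glueMk_eq_of_ne {i j : ι} (hij : i ≠ j) {a : V i} {b : V j}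
    (h : glueMk w i a = glueMk w j b) : a = w i ∧ b = w j := by
  rcases glueMk_eq_glueMk_iff.mp h with h | h
  · exact absurd (congrArg Sigma.fst h) hij
  · exact h

theorem index_eq_of_glueMk_eq {i j : ι} {a : V i} {b : V j} (ha : a ≠ w i)
    (h : glueMk w i a = glueMk w j b) : i = j := by
  by_contra hij
  exact ha (glueMk_eq_of_ne hij h).1

theorem glue_adj_glueMk_iff {i : ι} {a b : V i} :
    (glue G w).Adj (glueMk w i a) (glueMk w i b) ↔ (G i).Adj a b := by
  constructor
  · rintro ⟨j, a', b', h, ha, hb⟩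
    by_cases hij : i = j
    · subst hij
      rwa [glueMk_injective w i ha, glueMk_injective w i hb]
    · exact absurd ((glueMk_eq_of_ne hij ha).2.trans (glueMk_eq_of_ne hij hb).2.symm) h.ne
  · exact fun h => ⟨i, a, b, h, rfl, rfl⟩

/-- The inclusion of the `i`-th graph into the glued graph. -/
def glueEmbedding (G : ∀ i, SimpleGraph (V i)) (w : ∀ i, V i) (i : ι) : G i ↪g glue G w where
  toFun := glueMk w i
  inj' := glueMk_injective w i
  map_rel_iff' := glue_adj_glueMk_iff

/-- The vertices of the `i`-th graph other than the base point. -/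
def gluePart (w : ∀ i, V i) (i : ι) : Set (GlueVertex w) := glueMk w i '' {w i}ᶜ

theorem mem_gluePart {i j : ι} {a : V j} :
    glueMk w j a ∈ gluePart w i ↔ a ≠ w j ∧ j = i := by
  constructor
  · rintro ⟨b, hb, h⟩
    obtain rfl := index_eq_of_glueMk_eq hb h
    exact ⟨by rwa [← glueMk_injective w _ h], rfl⟩
  · rintro ⟨h, rfl⟩
    exact ⟨a, h, rfl⟩

theorem mem_gluePart_of_adj {i j : ι} {x y : GlueVertex w} (h : (glue G w).Adj x y)
    (hx : x ∈ gluePart w i) (hy : y ≠ glueMk w j (w j)) : y ∈ gluePart w i := by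
  obtain ⟨l, a, b, h, rfl, rfl⟩ := h
  rw [mem_gluePart] at hx ⊢
  exact ⟨fun hb => hy (glueMk_eq_base_iff.mpr hb), hx.2⟩

theorem gluePart_subset_range (i : ι) : gluePart w i ⊆ Set.range (glueMk w i) :=
  Set.image_subset_range _ _

theorem base_mem_support_of_notMem_gluePart {i j : ι} {x y : GlueVertex w}
    (p : (glue G w).Walk x y) (hx : x ∈ gluePart w i) (hy : y ∉ gluePart w i) :
    glueMk w j (w j) ∈ p.support := by
  induction p with
  | nil => exact absurd hx hy
  | @cons x z y h p ih =>
    by_cases hz : z = glueMk w j (w j)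
    · subst hz
      simp
    · simp [ih (mem_gluePart_of_adj h hx hz) hy]

/-- A vertex `z` outside part `i` would force the base point into the path both before and after
`z`. -/
theorem mem_range_of_mem_support {i : ι} {x y : GlueVertex w} {p : (glue G w).Walk x y}
    (hp : p.IsPath) (hx : x ∈ Set.range (glueMk w i)) (hy : y ∈ Set.range (glueMk w i)) :
    ∀ z ∈ p.support, z ∈ Set.range (glueMk w i) := by
  classical
  intro z hz
  obtain ⟨j, c, rfl⟩ := exists_eq_glueMk z
  by_contra hz'
  have hj : j ≠ i := by
    rintro rfl
    exact hz' ⟨c, rfl⟩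
  have hc : c ≠ w j := by
    rintro rfl
    exact hz' ⟨w i, glueMk_base i j⟩
  have hzj : glueMk w j c ∈ gluePart w j := mem_gluePart.mpr ⟨hc, rfl⟩
  have hnot : ∀ v ∈ Set.range (glueMk w i), v ∉ gluePart w j := by
    rintro _ ⟨a, rfl⟩ h
    exact hj (mem_gluePart.mp h).2.symm
  have h1 := base_mem_support_of_notMem_gluePart (j := i) (p.takeUntil _ hz).reverse hzj
    (hnot x hx)
  have h2 := base_mem_support_of_notMem_gluePart (j := i) (p.dropUntil _ hz) hzj (hnot y hy)
  have hne : glueMk w i (w i) ≠ glueMk w j c := fun h => hc (glueMk_eq_of_ne hj.symm h).2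
  rw [Walk.support_reverse, List.mem_reverse] at h1
  have hp' := hp
  rw [← p.take_spec hz] at hp'
  exact hp'.ne_of_mem_support_of_append hne h1 h2 rfl

theorem glue_connected [Nonempty ι] (hG : ∀ i, (G i).Connected) : (glue G w).Connected := by
  obtain ⟨i₀⟩ := ‹Nonempty ι›
  refine connected_iff_exists_forall_reachable _ |>.mpr ⟨glueMk w i₀ (w i₀), fun x => ?_⟩
  obtain ⟨i, a, rfl⟩ := exists_eq_glueMk x
  rw [glueMk_base i₀ i]
  exact ((hG i).preconnected (w i) a).map (glueEmbedding G w i).toHom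

variable [Finite ι] [∀ i, Finite (V i)]

theorem detourDist_glueMk_same (hG : ∀ i, (G i).Connected) (i : ι) (a b : V i) :
    (glue G w).detourDist (glueMk w i a) (glueMk w i b) = (G i).detourDist a b := by
  have : Nonempty ι := ⟨i⟩
  apply le_antisymm
  · obtain ⟨p, hp, hlen⟩ := (glue_connected (w := w) hG).exists_isPath_length_eq_detourDist
      (glueMk w i a) (glueMk w i b)
    obtain ⟨q, hq : q.map (glueEmbedding G w i).toHom = p⟩ :=
      (glueEmbedding G w i).exists_walk_map_eq p
        (mem_range_of_mem_support hp ⟨a, rfl⟩ ⟨b, rfl⟩) a b rfl rfl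
    subst hq
    rw [← hlen]
    exact (Walk.length_map _ _).trans_le hp.of_map.length_le_detourDist
  · obtain ⟨p, hp, hlen⟩ := (hG i).exists_isPath_length_eq_detourDist a b
    have := (hp.map (f := (glueEmbedding G w i).toHom)
      (glueEmbedding G w i).injective).length_le_detourDist
    rw [Walk.length_map, hlen] at this
    exact this

theorem detourDist_glueMk_of_ne (hG : ∀ i, (G i).Connected) {i j : ι} (hij : i ≠ j) (a : V i)
    (b : V j) :
    (glue G w).detourDist (glueMk w i a) (glueMk w j b) =
      (G i).detourDist (w i) a + (G j).detourDist (w j) b := by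
  have : Nonempty ι := ⟨i⟩
  apply le_antisymm
  · have := (glue_connected (w := w) hG).detourDist_triangle (glueMk w i a) (glueMk w i (w i))
      (glueMk w j b)
    rw [detourDist_glueMk_same hG, glueMk_base i j, detourDist_glueMk_same hG,
      detourDist_comm a (w i)] at this
    exact this
  · obtain ⟨p, hp, hlen⟩ := (hG i).exists_isPath_length_eq_detourDist a (w i)
    obtain ⟨q, hq, hlen'⟩ := (hG j).exists_isPath_length_eq_detourDist (w j) b
    have hp' := hp.map (f := (glueEmbedding G w i).toHom) (glueEmbedding G w i).injective
    have hq' := hq.map (f := (glueEmbedding G w j).toHom) (glueEmbedding G w j).injective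
    have hw : (glueEmbedding G w j).toHom (w j) = (glueEmbedding G w i).toHom (w i) :=
      glueMk_base j i
    have hq'' := (Walk.isPath_copy (q.map (glueEmbedding G w j).toHom) hw rfl).mpr hq'
    have := (hp'.append_of_support_inter hq'' fun x hx hx' => by
      simp only [Walk.support_copy, Walk.support_map, List.mem_map] at hx hx'
      obtain ⟨c, -, rfl⟩ := hx
      obtain ⟨d, -, hd⟩ := hx'
      have hd' : glueMk w i c = glueMk w j d := hd.symm
      rw [(glueMk_eq_of_ne hij hd').1]).length_le_detourDist
    rw [Walk.length_append, Walk.length_copy, Walk.length_map, Walk.length_map, hlen, hlen',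
      detourDist_comm a (w i)] at this
    exact this

end Glue

/-! ### Center and levels of the glued graph. -/

section GlueCenter

variable {ι : Type*} [Finite ι] {V : ι → Type*} [∀ i, Fintype (V i)] {w : ∀ i, V i}
  {G : ∀ i, SimpleGraph (V i)}

theorem detourDist_base_glueMk (hG : ∀ i, (G i).Connected) (i j : ι) (a : V j) :
    (glue G w).detourDist (glueMk w i (w i)) (glueMk w j a) = (G j).detourDist (w j) a := by
  rw [glueMk_base i j, detourDist_glueMk_same hG]

theorem detourCenter_glue (hG : ∀ i, (G i).Connected) (hc : ∀ i, (G i).detourCenter = {w i})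
    (i₀ : ι) : (glue G w).detourCenter = {glueMk w i₀ (w i₀)} := by
  refine detourCenter_eq_singleton fun x hx => ?_
  obtain ⟨i, a, rfl⟩ := exists_eq_glueMk x
  have ha : a ≠ w i := fun h => hx (glueMk_eq_base_iff.mpr h)
  obtain ⟨y, hy⟩ := exists_detourDist_eq_detourEcc (G := glue G w) (glueMk w i₀ (w i₀))
  obtain ⟨j, b, rfl⟩ := exists_eq_glueMk y
  rw [← hy, detourDist_base_glueMk hG]
  -- The vertex `b` is farthest from the base point. If `a` lies in the same part, the strict
  -- inequality of eccentricities there suffices; otherwise a detour from `a` to `b` is longer by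
  -- `D(w i, a) > 0`.
  by_cases hij : i = j
  · subst hij
    obtain ⟨c, hcc⟩ := exists_detourDist_eq_detourEcc (G := G i) a
    have h1 := detourDist_le_detourEcc (G := glue G w) (glueMk w i a) (glueMk w i c)
    rw [detourDist_glueMk_same hG] at h1
    have h2 := detourEcc_lt_of_detourCenter_eq (hc i) ha
    have h3 := detourDist_le_detourEcc (G := G i) (w i) b
    omega
  · have h1 := detourDist_le_detourEcc (G := glue G w) (glueMk w i a) (glueMk w j b)
    rw [detourDist_glueMk_of_ne hG hij] at h1
    have h2 : (G i).detourDist (w i) a ≠ 0 := fun h => ha ((hG i).detourDist_eq_zero_iff.mp h).symm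
    omega

theorem detourLevel_glueMk (hG : ∀ i, (G i).Connected) (hc : ∀ i, (G i).detourCenter = {w i})
    (i : ι) (a : V i) : (glue G w).detourLevel (glueMk w i a) = (G i).detourLevel a := by
  rw [detourLevel_eq (detourCenter_glue hG hc i), detourLevel_eq (hc i), detourDist_base_glueMk hG]

end GlueCenter

/-! ### Sums over the glued vertex set. -/

section GlueSum

variable {ι : Type*} [Fintype ι] {V : ι → Type*} [∀ i, Fintype (V i)] {w : ∀ i, V i}

theorem sum_glueVertex {M : Type*} [AddCommMonoid M] (f : GlueVertex w → M)
    (hf : ∀ i, f (glueMk w i (w i)) = 0) : ∑ x, f x = ∑ i, ∑ a, f (glueMk w i a) := by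
  classical
  rw [Finset.sum_sigma' Finset.univ (fun _ => Finset.univ) fun i a => f (glueMk w i a)]
  rw [← Finset.sum_filter_of_ne (p := fun y : Σ i, V i => y.2 ≠ w y.1)
    (fun y _ hy h => hy (by rw [h]; exact hf y.1))]
  rw [← Finset.sum_filter_of_ne (s := Finset.univ) (f := f) (p := fun x => ∀ i, x ≠ glueMk w i (w i))
    (fun x _ hx i h => hx (by rw [h]; exact hf i))]
  symm
  refine Finset.sum_bij (fun y _ => glueMk w y.1 y.2) ?_ ?_ ?_ ?_
  · rintro ⟨i, a⟩ hy
    simp only [Finset.univ_sigma_univ, Finset.mem_filter, Finset.mem_univ, true_and] at hy ⊢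
    exact fun j h => hy (glueMk_eq_base_iff.mp h)
  · rintro ⟨i, a⟩ hy ⟨j, b⟩ hz h
    simp only [Finset.univ_sigma_univ, Finset.mem_filter, Finset.mem_univ, true_and] at hy
    rcases glueMk_eq_glueMk_iff.mp h with h | h
    · exact h
    · exact absurd h.1 hy
  · intro x hx
    obtain ⟨i, a, rfl⟩ := exists_eq_glueMk x
    refine ⟨⟨i, a⟩, ?_, rfl⟩
    simp only [Finset.univ_sigma_univ, Finset.mem_filter, Finset.mem_univ, true_and] at hx ⊢
    exact fun h => hx i (by rw [h])
  · intros; rfl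

theorem card_glueVertex_sub_one [Nonempty ι] :
    (Fintype.card (GlueVertex w) : ℤ) - 1 = ∑ i, ((Fintype.card (V i) : ℤ) - 1) := by
  classical
  obtain ⟨i₀⟩ := ‹Nonempty ι›
  -- Subtracting the indicator of the base point makes the summand vanish where the parts overlap.
  have h := sum_glueVertex (w := w) (fun x => (1 : ℤ) - if x = glueMk w i₀ (w i₀) then 1 else 0)
    (fun i => by simp [glueMk_base i i₀])
  simpa [glueMk_eq_base_iff] using h

end GlueSum

/-! ### Nonseparable subgraphs under embeddings. -/

section Transport

variable {V V' : Type*} {G : SimpleGraph V} {G' : SimpleGraph V'}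

theorem IsCutVertex.map_iso (e : G ≃g G') {v : V} (h : G.IsCutVertex v) : G'.IsCutVertex (e v) := by
  obtain ⟨a, b, ha, hb, hab, hn⟩ := h
  refine ⟨e a, e b, fun h => ha (e.injective h), fun h => hb (e.injective h),
    hab.map e.toHom, fun h => hn ?_⟩
  let g : G'.induce {e v}ᶜ →g G.induce {v}ᶜ :=
    { toFun := fun x => ⟨e.symm x, fun h => x.2 (e.symm_apply_eq.mp h)⟩
      map_rel' := fun {x y} h => e.symm.map_adj_iff.mpr h }
  have h' := h.map g
  have hga : g ⟨e a, fun h => ha (e.injective h)⟩ = ⟨a, ha⟩ := Subtype.ext (e.symm_apply_apply a)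
  have hgb : g ⟨e b, fun h => hb (e.injective h)⟩ = ⟨b, hb⟩ := Subtype.ext (e.symm_apply_apply b)
  rwa [hga, hgb] at h'

theorem Iso.isCutVertex_iff (e : G ≃g G') {v : V} : G'.IsCutVertex (e v) ↔ G.IsCutVertex v :=
  ⟨fun h => by simpa using h.map_iso e.symm, fun h => h.map_iso e⟩

/-- A connected subgraph without a cut vertex of its own. -/
def Subgraph.IsNonseparable (H : G.Subgraph) : Prop :=
  H.Connected ∧ ∀ v : H.verts, ¬ H.coe.IsCutVertex v

theorem Subgraph.map_embedding_adj (f : G ↪g G') (H : G.Subgraph) {a b : V} :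
    (H.map f.toHom).Adj (f a) (f b) ↔ H.Adj a b :=
  Relation.map_apply_apply f.injective f.injective _ _ _

/-- A subgraph is isomorphic to its image under an embedding. -/
noncomputable def Subgraph.isoMap (f : G ↪g G') (H : G.Subgraph) : H.coe ≃g (H.map f.toHom).coe where
  toEquiv := Equiv.Set.image f H.verts f.injective
  map_rel_iff' := Subgraph.map_embedding_adj f H

theorem Subgraph.isNonseparable_map_iff (f : G ↪g G') {H : G.Subgraph} :
    (H.map f.toHom).IsNonseparable ↔ H.IsNonseparable := by
  unfold IsNonseparable
  rw [Subgraph.connected_iff', Subgraph.connected_iff', ← (H.isoMap f).connected_iff,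
    ← (H.isoMap f).toEquiv.forall_congr_right]
  exact and_congr_right fun _ => forall_congr' fun v => not_congr (H.isoMap f).isCutVertex_iff

theorem Subgraph.comap_map_embedding (f : G ↪g G') (H : G.Subgraph) :
    (H.map f.toHom).comap f.toHom = H := by
  apply Subgraph.ext
  · exact Set.preimage_image_eq _ f.injective
  · ext a b
    simp only [Subgraph.comap_adj]
    exact ⟨fun h => (H.map_embedding_adj f).mp h.2,
      fun h => ⟨h.adj_sub, (H.map_embedding_adj f).mpr h⟩⟩

theorem Subgraph.map_comap_embedding (f : G ↪g G') {H : G'.Subgraph}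
    (h : H.verts ⊆ Set.range f) : (H.comap f.toHom).map f.toHom = H := by
  apply le_antisymm
  · exact (Subgraph.map_le_iff_le_comap _ _ _).mpr le_rfl
  · refine ⟨fun x hx => ?_, fun x y hxy => ?_⟩
    · obtain ⟨a, rfl⟩ := h hx
      exact ⟨a, hx, rfl⟩
    · obtain ⟨a, rfl⟩ := h hxy.fst_mem
      obtain ⟨b, rfl⟩ := h hxy.snd_mem
      exact (Subgraph.map_embedding_adj f _).mpr ⟨f.map_adj_iff.mp hxy.adj_sub, hxy⟩

theorem Subgraph.map_le_map_embedding_iff (f : G ↪g G') {H K : G.Subgraph} :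
    H.map f.toHom ≤ K.map f.toHom ↔ H ≤ K := by
  rw [Subgraph.map_le_iff_le_comap, Subgraph.comap_map_embedding]

end Transport

/-! ### Blocks and `ξ` of the glued graph. -/

section GlueBlocks

variable {ι : Type*} {V : ι → Type*} {w : ∀ i, V i} {G : ∀ i, SimpleGraph (V i)}

theorem Subgraph.Connected.base_mem {H : (glue G w).Subgraph} (hH : H.Connected) {i j : ι}
    {x y : GlueVertex w} (hx : x ∈ H.verts) (hy : y ∈ H.verts) (hxi : x ∈ gluePart w i)
    (hyi : y ∉ gluePart w i) : glueMk w j (w j) ∈ H.verts := by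
  obtain ⟨p⟩ := hH.coe.preconnected ⟨x, hx⟩ ⟨y, hy⟩
  have := base_mem_support_of_notMem_gluePart (j := j) (p.map H.hom) hxi hyi
  rw [Walk.support_map, List.mem_map] at this
  obtain ⟨z, -, hz⟩ := this
  rw [← hz]
  exact z.2

/-- Otherwise the base point lies in `H` and separates `x` from `y` there, so it is a cut vertex of
`H`. -/
theorem Subgraph.IsNonseparable.mem_gluePart_of_mem {H : (glue G w).Subgraph}
    (hH : H.IsNonseparable) {i j : ι} {x y : GlueVertex w} (hx : x ∈ H.verts) (hy : y ∈ H.verts)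
    (hxi : x ∈ gluePart w i) (hyw : y ≠ glueMk w j (w j)) : y ∈ gluePart w i := by
  by_contra hyi
  have hw := hH.1.base_mem (j := j) hx hy hxi hyi
  have hxw : x ≠ glueMk w j (w j) := by
    rintro rfl
    exact (mem_gluePart.mp hxi).1 rfl
  refine hH.2 ⟨_, hw⟩ ⟨⟨x, hx⟩, ⟨y, hy⟩, fun h => hxw (congrArg Subtype.val h),
    fun h => hyw (congrArg Subtype.val h), hH.1.coe.preconnected _ _, ?_⟩
  rintro ⟨p⟩
  have hmem := base_mem_support_of_notMem_gluePart (j := j)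
    (p.map (H.hom.comp (Embedding.induce _).toHom)) hxi hyi
  rw [Walk.support_map, List.mem_map] at hmem
  obtain ⟨z, -, hz⟩ := hmem
  exact z.2 (Subtype.ext hz)

theorem Subgraph.IsNonseparable.exists_verts_subset_range [Nonempty ι] {H : (glue G w).Subgraph}
    (hH : H.IsNonseparable) : ∃ i, H.verts ⊆ Set.range (glueMk w i) := by
  obtain ⟨i₀⟩ := ‹Nonempty ι›
  by_cases h : ∃ x ∈ H.verts, x ≠ glueMk w i₀ (w i₀)
  · obtain ⟨x, hx, hxw⟩ := h
    obtain ⟨i, a, rfl⟩ := exists_eq_glueMk x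
    have hxi : glueMk w i a ∈ gluePart w i :=
      mem_gluePart.mpr ⟨fun h => hxw (glueMk_eq_base_iff.mpr h), rfl⟩
    refine ⟨i, fun y hy => ?_⟩
    by_cases hyw : y = glueMk w i₀ (w i₀)
    · exact ⟨w i, by rw [hyw, glueMk_base]⟩
    · exact gluePart_subset_range i (hH.mem_gluePart_of_mem hx hy hxi hyw)
  · push Not at h
    exact ⟨i₀, fun x hx => ⟨w i₀, (h x hx).symm⟩⟩

theorem Subgraph.IsNonseparable.exists_eq_map [Nonempty ι] {H : (glue G w).Subgraph}
    (hH : H.IsNonseparable) :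
    ∃ i, ∃ K : (G i).Subgraph, K.IsNonseparable ∧ H = K.map (glueEmbedding G w i).toHom := by
  obtain ⟨i, hi⟩ := hH.exists_verts_subset_range
  have h := Subgraph.map_comap_embedding (glueEmbedding G w i) hi
  refine ⟨i, _, ?_, h.symm⟩
  rwa [← Subgraph.isNonseparable_map_iff (glueEmbedding G w i), h]

theorem IsBlock.exists_eq_map [Nonempty ι] {B : (glue G w).Subgraph}
    (hB : (glue G w).IsBlock B) :
    ∃ i, ∃ K : (G i).Subgraph, (G i).IsBlock K ∧ B = K.map (glueEmbedding G w i).toHom := by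
  obtain ⟨i, K, hK, rfl⟩ := Subgraph.IsNonseparable.exists_eq_map hB.1
  refine ⟨i, K, ⟨hK, fun L hL hKL => ?_⟩, rfl⟩
  rw [← Subgraph.map_le_map_embedding_iff (glueEmbedding G w i)] at hKL ⊢
  exact hB.2 ((Subgraph.isNonseparable_map_iff (glueEmbedding G w i)).mpr hL) hKL

/-- A block of a nontrivial connected graph has a vertex off the base point. This vertex pins any
larger nonseparable subgraph to the same part, where maximality of `K` applies. -/
theorem IsBlock.map_glueEmbedding {i : ι} [Nontrivial (V i)] (hG : (G i).Connected)
    {K : (G i).Subgraph} (hK : (G i).IsBlock K) :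
    (glue G w).IsBlock (K.map (glueEmbedding G w i).toHom) := by
  have : Nonempty ι := ⟨i⟩
  refine ⟨(Subgraph.isNonseparable_map_iff (glueEmbedding G w i)).mpr hK.1, fun H hH hKH => ?_⟩
  obtain ⟨j, L, hL, rfl⟩ := Subgraph.IsNonseparable.exists_eq_map hH
  obtain ⟨a, ha, haw⟩ := hK.exists_ne_mem hG (w i)
  obtain ⟨b, -, hb⟩ := hKH.1 ⟨a, ha, rfl⟩
  obtain rfl : i = j := index_eq_of_glueMk_eq haw hb.symm
  rw [Subgraph.map_le_map_embedding_iff] at hKH ⊢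
  exact hK.2 hL hKH

theorem isBlockGraph_glue [Nonempty ι] (hG : ∀ i, (G i).IsBlockGraph) :
    (glue G w).IsBlockGraph := by
  refine ⟨glue_connected fun i => (hG i).1, fun B hB => ?_⟩
  obtain ⟨i, K, hK, rfl⟩ := hB.exists_eq_map
  rintro _ ⟨a, ha, rfl⟩ _ ⟨b, hb, rfl⟩ hab
  exact (Subgraph.map_embedding_adj (glueEmbedding G w i) K).mpr
    ((hG i).2 K hK ha hb fun h => hab (by rw [h]))

theorem isLeast_detourXi_glue [Finite ι] [Nonempty ι] [∀ i, Fintype (V i)] [∀ i, Nontrivial (V i)]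
    (hG : ∀ i, (G i).Connected) (hc : ∀ i, (G i).detourCenter = {w i}) :
    IsLeast (Set.range fun i => (G i).detourXi) (glue G w).detourXi := by
  obtain ⟨i₀⟩ := ‹Nonempty ι›
  have hmem (i : ι) : ∃ B : (G i).Subgraph, (G i).IsBlock B ∧ w i ∈ B.verts ∧
      B.verts.ncard - 1 = (G i).detourXi := by
    rw [detourXi_eq (hc i)]
    obtain ⟨B, hB, hw⟩ := (hG i).exists_isBlock_mem (w i)
    exact Nat.sInf_mem (s := {m : ℕ | ∃ B : (G i).Subgraph, (G i).IsBlock B ∧ w i ∈ B.verts ∧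
      B.verts.ncard - 1 = m}) ⟨_, B, hB, hw, rfl⟩
  have hncard (i : ι) (B : (G i).Subgraph) :
      (B.map (glueEmbedding G w i).toHom).verts.ncard = B.verts.ncard :=
    Set.ncard_image_of_injective _ (glueEmbedding G w i).injective
  have hle (i : ι) : (glue G w).detourXi ≤ (G i).detourXi := by
    obtain ⟨B, hB, hw, h⟩ := hmem i
    rw [← h, ← hncard, detourXi_eq (detourCenter_glue hG hc i)]
    exact Nat.sInf_le ⟨_, hB.map_glueEmbedding (hG i), ⟨w i, hw, rfl⟩, rfl⟩
  refine ⟨?_, Set.forall_mem_range.mpr hle⟩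
  obtain ⟨B, hB, hw, h⟩ : ∃ B : (glue G w).Subgraph, (glue G w).IsBlock B ∧
      glueMk w i₀ (w i₀) ∈ B.verts ∧ B.verts.ncard - 1 = (glue G w).detourXi := by
    rw [detourXi_eq (detourCenter_glue hG hc i₀)]
    obtain ⟨B, hB, hw, -⟩ := hmem i₀
    exact Nat.sInf_mem (s := {m : ℕ | ∃ B : (glue G w).Subgraph, (glue G w).IsBlock B ∧
      glueMk w i₀ (w i₀) ∈ B.verts ∧ B.verts.ncard - 1 = m})
      ⟨_, _, hB.map_glueEmbedding (hG i₀), ⟨w i₀, hw, rfl⟩, rfl⟩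
  have := Nonempty.intro i₀
  obtain ⟨i, K, hK, rfl⟩ := hB.exists_eq_map
  obtain ⟨a, ha, haw⟩ := hw
  obtain rfl : a = w i := glueMk_eq_base_iff.mp haw
  refine ⟨i, le_antisymm ?_ (hle i)⟩
  dsimp only
  rw [← h, hncard, detourXi_eq (hc i)]
  exact Nat.sInf_le ⟨K, hK, ha, rfl⟩

end GlueBlocks

/-! ### Enumerations, ranks and sums along them. -/

section Enumeration

theorem exists_bijOn_monotone {V : Type*} [Fintype V] [Nonempty V] (f : V → ℕ) :
    ∃ u : ℕ → V, Set.BijOn u (Set.Iio (Fintype.card V)) Set.univ ∧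
      ∀ i j, i ≤ j → j < Fintype.card V → f (u i) ≤ f (u j) := by
  let e := (Fintype.equivFin V).symm
  let s := Tuple.sort (f ∘ e)
  have hs : Monotone ((f ∘ e) ∘ s) := Tuple.monotone_sort _
  let d : V := Classical.arbitrary V
  let u : ℕ → V := fun t => if h : t < Fintype.card V then e (s ⟨t, h⟩) else d
  have hu (t : ℕ) (h : t < Fintype.card V) : u t = e (s ⟨t, h⟩) := dif_pos h
  refine ⟨u, ⟨fun _ _ => Set.mem_univ _, ?_, ?_⟩, ?_⟩
  · intro a ha b hb hab
    rw [hu a ha, hu b hb] at hab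
    exact congrArg Fin.val (s.injective (e.injective hab))
  · intro x _
    refine ⟨s.symm (e.symm x), (s.symm (e.symm x)).2, ?_⟩
    rw [hu _ (s.symm (e.symm x)).2]
    simp
  · intro i j hij hj
    rw [hu i (hij.trans_lt hj), hu j hj]
    exact hs hij

theorem sum_range_of_bijOn {V M : Type*} [Fintype V] [AddCommMonoid M] {u : ℕ → V}
    (hu : Set.BijOn u (Set.Iio (Fintype.card V)) Set.univ) (g : V → M) :
    ∑ t ∈ Finset.range (Fintype.card V), g (u t) = ∑ x, g x := by
  refine Finset.sum_bij (fun t _ => u t) (fun _ _ => Finset.mem_univ _) ?_ ?_ fun _ _ => rfl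
  · intro a ha b hb h
    exact hu.injOn (by simpa using ha) (by simpa using hb) h
  · intro x _
    obtain ⟨t, ht, rfl⟩ := hu.surjOn (Set.mem_univ x)
    exact ⟨t, by simpa using ht, rfl⟩

theorem sum_Ico_add_succ (a : ℕ → ℤ) {i j : ℕ} (hij : i < j) :
    ∑ t ∈ Finset.Ico i j, (a t + a (t + 1)) = a i + a j + 2 * ∑ t ∈ Finset.Ioo i j, a t := by
  rw [Finset.sum_add_distrib, Finset.sum_Ico_add' a i j 1, ← Finset.sum_Ico_consecutive a
    (show i + 1 ≤ j from hij) (Nat.le_succ j)]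
  rw [← Finset.add_sum_Ioo_eq_sum_Ico hij, Nat.Ico_succ_singleton]
  have : Finset.Ico (i + 1) j = Finset.Ioo i j := by
    ext; simp
  rw [this, Finset.sum_singleton]
  ring

theorem sum_Ioo_rank {V : Type*} [Fintype V] {u : ℕ → V}
    (hu : Set.BijOn u (Set.Iio (Fintype.card V)) Set.univ) {f : V → ℕ} {i j : ℕ}
    (hj : j < Fintype.card V)
    (hlt : ∀ s t, s < Fintype.card V → t < Fintype.card V → (f (u s) < f (u t) ↔ s < t))
    (hi : i < Fintype.card V) (g : V → ℤ) :
    ∑ t ∈ Finset.Ioo i j, g (u t) = ∑ z with f (u i) < f z ∧ f z < f (u j), g z := by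
  refine Finset.sum_bij (fun t _ => u t) ?_ ?_ ?_ fun _ _ => rfl
  · intro t ht
    rw [Finset.mem_Ioo] at ht
    simp [hlt i t hi (ht.2.trans hj), hlt t j (ht.2.trans hj) hj, ht]
  · intro a ha b hb h
    rw [Finset.mem_Ioo] at ha hb
    exact hu.injOn (ha.2.trans hj) (hb.2.trans hj) h
  · intro z hz
    obtain ⟨t, ht, rfl⟩ := hu.surjOn (Set.mem_univ z)
    replace ht : t < Fintype.card V := ht
    simp only [Finset.mem_filter, Finset.mem_univ, true_and] at hz
    rw [hlt i t hi ht, hlt t j ht hj] at hz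
    exact ⟨t, Finset.mem_Ioo.mpr hz, rfl⟩

end Enumeration

/-! ### Condition `(*)` in terms of ranks. -/

section Ordering

variable {V : Type*} [Fintype V] {G : SimpleGraph V}

/-- `f` ranks the vertices in an order witnessing `HasDetourOrdering` for a graph with `ω = 1`. -/
structure IsDetourRank (G : SimpleGraph V) (f : V → ℕ) : Prop where
  injective : Function.Injective f
  first : ∃ x, G.detourLevel x = 0 ∧ ∀ y, f x ≤ f y
  last : ∃ x, G.detourLevel x = G.detourXi ∧ ∀ y, f y ≤ f x
  le : ∀ x y, f x < f y → (G.detourLevel x : ℤ) + G.detourLevel y ≤ G.detourDist x y +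
    ∑ z with f x < f z ∧ f z < f y, ((Fintype.card V : ℤ) - 1 - 2 * G.detourLevel z)

/-- There are `j - i - 1` interior indices; each occurs twice in the level sum and absorbs one copy
of `n - 1`. -/
theorem detourOrdering_bound_eq (L : ℕ → ℤ) (n : ℤ) {i j : ℕ} (hij : i < j) :
    ∑ t ∈ Finset.Ico i j, (L t + L (t + 1)) - ((j : ℤ) - i) * (n - (1 : ℕ)) + (n - 1) =
      L i + L j - ∑ t ∈ Finset.Ioo i j, (n - 1 - 2 * L t) := by
  rw [sum_Ico_add_succ L hij, Finset.sum_sub_distrib, Finset.sum_const, Nat.card_Ioo,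
    ← Finset.mul_sum, nsmul_eq_mul, Nat.sub_sub, Nat.cast_sub hij]
  push_cast
  ring

/-- Ranks may have gaps, so orderings can be concatenated without index arithmetic. -/
theorem hasDetourOrdering_iff_exists_isDetourRank [Nonempty V] (hω : G.detourOmega = 1) :
    G.HasDetourOrdering ↔ ∃ f, G.IsDetourRank f := by
  have hn : 0 < Fintype.card V := Fintype.card_pos
  constructor
  · rintro ⟨u, hu, h0, h1, hle⟩
    let f : V → ℕ := Function.invFunOn u (Set.Iio (Fintype.card V))
    have hfu (t : ℕ) (ht : t < Fintype.card V) : f (u t) = t := hu.invOn_invFunOn.1 ht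
    have hsurj (x : V) : ∃ t < Fintype.card V, u t = x := hu.surjOn (Set.mem_univ x)
    have hlt (s t : ℕ) (hs : s < Fintype.card V) (ht : t < Fintype.card V) :
        f (u s) < f (u t) ↔ s < t := by rw [hfu s hs, hfu t ht]
    refine ⟨f, ?_, ⟨u 0, h0, ?_⟩, ⟨u (Fintype.card V - 1), h1, ?_⟩, ?_⟩
    · intro x y hxy
      obtain ⟨s, hs, rfl⟩ := hsurj x
      obtain ⟨t, ht, rfl⟩ := hsurj y
      rw [hfu s hs, hfu t ht] at hxy
      rw [hxy]
    · intro y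
      rw [hfu 0 hn]
      exact Nat.zero_le _
    · intro y
      obtain ⟨t, ht, rfl⟩ := hsurj y
      rw [hfu t ht, hfu _ (by omega)]
      omega
    · intro x y hxy
      obtain ⟨s, hs, rfl⟩ := hsurj x
      obtain ⟨t, ht, rfl⟩ := hsurj y
      rw [hlt s t hs ht] at hxy
      have := hle s t hxy ht
      rw [hω, detourOrdering_bound_eq (fun t => (G.detourLevel (u t) : ℤ)) _ hxy,
        sum_Ioo_rank (f := f) hu ht hlt hs
          fun z => (Fintype.card V : ℤ) - 1 - 2 * G.detourLevel z] at this
      linarith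
  · rintro ⟨f, hinj, ⟨x, hx, hx'⟩, ⟨y, hy, hy'⟩, hle⟩
    obtain ⟨u, hu, hmono⟩ := exists_bijOn_monotone f
    have hsurj (x : V) : ∃ t < Fintype.card V, u t = x := hu.surjOn (Set.mem_univ x)
    have hlt (s t : ℕ) (hs : s < Fintype.card V) (ht : t < Fintype.card V) :
        f (u s) < f (u t) ↔ s < t := by
      constructor
      · intro h
        by_contra hts
        exact absurd (hmono t s (not_lt.mp hts) hs) (not_le.mpr h)
      · intro h
        exact lt_of_le_of_ne (hmono s t h.le ht) fun h' => h.ne (hu.injOn hs ht (hinj h'))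
    refine ⟨u, hu, ?_, ?_, ?_⟩
    · obtain ⟨t, ht, rfl⟩ := hsurj x
      rwa [hinj (le_antisymm (hmono 0 t (Nat.zero_le t) ht) (hx' _))]
    · obtain ⟨t, ht, rfl⟩ := hsurj y
      rwa [← hinj (le_antisymm (hmono t (Fintype.card V - 1) (by omega) (by omega)) (hy' _))]
    · intro i j hij hj
      have := hle (u i) (u j) ((hlt i j (hij.trans hj) hj).mpr hij)
      rw [hω, detourOrdering_bound_eq (fun t => (G.detourLevel (u t) : ℤ)) _ hij,
        sum_Ioo_rank (f := f) hu hj hlt (hij.trans hj)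
          fun z => (Fintype.card V : ℤ) - 1 - 2 * G.detourLevel z]
      linarith

theorem detourDist_of_card_eq_two (hG : G.Connected) (hn : Fintype.card V = 2) {u v : V}
    (huv : u ≠ v) : G.detourDist u v = 1 := by
  have h1 := hG.detourDist_lt_card u v
  have h2 : G.detourDist u v ≠ 0 := fun h => huv (hG.detourDist_eq_zero_iff.mp h)
  omega

theorem card_ne_two_of_detourCenter_eq (hG : G.Connected) {w : V} (hw : G.detourCenter = {w}) :
    Fintype.card V ≠ 2 := by
  intro hn
  have : Nontrivial V := Fintype.one_lt_card_iff_nontrivial.mp (by omega)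
  obtain ⟨v, hv⟩ := exists_ne w
  obtain ⟨y, hy⟩ := exists_detourDist_eq_detourEcc (G := G) v
  have h1 := detourEcc_lt_of_detourCenter_eq hw hv
  have h2 := detourDist_le_detourEcc (G := G) w v
  rw [detourDist_of_card_eq_two hG hn hv.symm] at h2
  have := hG.detourDist_lt_card v y
  omega

theorem two_mul_detourLevel_lt_card [Nontrivial V] (hG : G.IsBlockGraph) {w : V}
    (hw : G.detourCenter = {w}) (hord : G.HasDetourOrdering) (x : V) :
    2 * G.detourLevel x < Fintype.card V := by
  obtain ⟨u, hu, h0, h1, hle⟩ := hord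
  have hn2 := card_ne_two_of_detourCenter_eq hG.1 hw
  have hn1 : 1 < Fintype.card V := Fintype.one_lt_card
  rw [detourOmega_eq_one hw] at hle
  have htri (a b : V) : G.detourDist a b ≤ G.detourLevel a + G.detourLevel b := by
    rw [detourLevel_eq hw, detourLevel_eq hw, detourDist_comm w a]
    exact hG.1.detourDist_triangle a w b
  have hu0 : u 0 = w := by
    rw [detourLevel_eq hw] at h0
    exact (hG.1.detourDist_eq_zero_iff.mp h0).symm
  have hne (t : ℕ) (ht : t < Fintype.card V) (ht0 : t ≠ 0) : u t ≠ w := by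
    rw [← hu0]
    exact fun h => ht0 (hu.injOn ht (by simp; omega) h)
  obtain ⟨t, ht, rfl⟩ := hu.surjOn (Set.mem_univ x)
  replace ht : t < Fintype.card V := ht
  by_cases ht0 : t = 0
  · subst ht0
    omega
  by_cases ht1 : t = Fintype.card V - 1
  · subst ht1
    -- The last vertex has level `ξ`, at most the levels of `u 1` and `u 2`, whose sum is at most
    -- `D(u 1, u 2) ≤ n - 1`. Both indices exist because `n ≥ 3`.
    have h := hle 1 2 (by omega) (by omega)
    have hd := hG.1.detourDist_lt_card (u 1) (u 2)
    have hx1 := hG.detourXi_le_detourDist hw (hne 1 (by omega) (by omega))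
    have hx2 := hG.detourXi_le_detourDist hw (hne 2 (by omega) (by omega))
    rw [← detourLevel_eq hw] at hx1 hx2
    rw [show Finset.Ico 1 2 = {1} from rfl, Finset.sum_singleton] at h
    norm_num at h
    omega
  -- For an interior vertex, `(*)` between its two neighbors and `D ≤ L + L` leave exactly `2 L(u t)
  -- ≤ n - 1`.
  · have h := hle (t - 1) (t + 1) (by omega) (by omega)
    have := htri (u (t - 1)) (u (t + 1))
    obtain ⟨s, rfl⟩ := Nat.exists_eq_succ_of_ne_zero ht0
    simp only [Nat.succ_eq_add_one, Nat.add_sub_cancel] at *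
    rw [Finset.sum_Ico_succ_top (by omega), Finset.sum_Ico_succ_top (by omega)] at h
    simp only [Finset.Ico_self, Finset.sum_empty, zero_add] at h
    push_cast at h
    ring_nf at h
    ring_nf at this
    ring_nf
    omega

end Ordering

/-! ### The hamiltonian chromatic number under `(*)`. -/

section HamiltonianColoring

variable {V : Type*} [Fintype V] {G : SimpleGraph V}

theorem sum_range_detourGap {u : ℕ → V}
    (hu : Set.BijOn u (Set.Iio (Fintype.card V)) Set.univ) (hn : 0 < Fintype.card V) :
    ∑ t ∈ Finset.range (Fintype.card V - 1), ((Fintype.card V : ℤ) - 1 -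
      G.detourLevel (u t) - G.detourLevel (u (t + 1))) =
    ((Fintype.card V : ℤ) - 1) * ((Fintype.card V : ℤ) - 1) - 2 * G.totalDetourLevel +
      G.detourLevel (u 0) + G.detourLevel (u (Fintype.card V - 1)) := by
  have h := sum_range_of_bijOn hu fun x => (G.detourLevel x : ℤ)
  obtain ⟨m, hm⟩ := Nat.exists_eq_succ_of_ne_zero hn.ne'
  rw [hm] at h ⊢
  rw [totalDetourLevel, Nat.cast_sum, ← h, Nat.succ_eq_add_one, Nat.add_sub_cancel,
    Finset.sum_sub_distrib, Finset.sum_sub_distrib]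
  have h1 := Finset.sum_range_succ (fun t => (G.detourLevel (u t) : ℤ)) m
  have h2 := Finset.sum_range_succ' (fun t => (G.detourLevel (u t) : ℤ)) m
  simp only [Finset.sum_const, Finset.card_range, nsmul_eq_mul]
  push_cast
  linarith

theorem le_hamiltonianColoring_sup [Nontrivial V] (hG : G.IsBlockGraph) {w : V}
    (hw : G.detourCenter = {w}) {c : V → ℕ} (hc : G.IsHamiltonianColoring c) :
    ((Fintype.card V : ℤ) - 1) * ((Fintype.card V : ℤ) - 1) - 2 * G.totalDetourLevel +
      G.detourXi ≤ Finset.univ.sup c := by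
  obtain ⟨u, hu, hmono⟩ := exists_bijOn_monotone c
  have hn1 : 1 < Fintype.card V := Fintype.one_lt_card
  have hgap := sum_range_detourGap (G := G) hu (by omega)
  have hle : ∑ t ∈ Finset.range (Fintype.card V - 1), ((Fintype.card V : ℤ) - 1 -
      G.detourLevel (u t) - G.detourLevel (u (t + 1))) ≤
      ∑ t ∈ Finset.range (Fintype.card V - 1), ((c (u (t + 1)) : ℤ) - c (u t)) := by
    refine Finset.sum_le_sum fun t ht => ?_
    rw [Finset.mem_range] at ht
    have hne : u t ≠ u (t + 1) := fun h => by
      have := hu.injOn (show t ∈ Set.Iio _ by simp; omega) (by simp; omega) h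
      omega
    have h1 := hc _ _ hne
    have h2 := hmono t (t + 1) (by omega) (by omega)
    have h3 := hG.1.detourDist_triangle (u t) w (u (t + 1))
    rw [detourDist_comm (u t) w, ← detourLevel_eq hw, ← detourLevel_eq hw] at h3
    rw [abs_sub_comm, abs_of_nonneg (by omega)] at h1
    omega
  rw [Finset.sum_range_sub (fun t => (c (u t) : ℤ)), hgap] at hle
  have hsup : c (u (Fintype.card V - 1)) ≤ Finset.univ.sup c :=
    Finset.le_sup (f := c) (Finset.mem_univ _)
  -- At most one end of the enumeration is `w`, and every other vertex has level at least `ξ`.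
  have hxi : G.detourXi ≤ G.detourLevel (u 0) + G.detourLevel (u (Fintype.card V - 1)) := by
    by_cases h0 : u 0 = w
    · have hne : u (Fintype.card V - 1) ≠ w := fun h => by
        have := hu.injOn (show 0 ∈ Set.Iio _ by simp; omega) (by simp; omega) (h0.trans h.symm)
        omega
      rw [detourLevel_eq hw (u (_ - 1))]
      exact (hG.detourXi_le_detourDist hw hne).trans (Nat.le_add_left _ _)
    · rw [detourLevel_eq hw (u 0)]
      exact (hG.detourXi_le_detourDist hw h0).trans (Nat.le_add_right _ _)
  omega

/-- Color `u t` by the sum `C t` of the first `t` gaps. With this choice `(*)` says exactly `D(u i,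
u j) + (C j - C i) ≥ n - 1`. The gaps are nonnegative by `(*)` for consecutive vertices, so the last
color is the largest. -/
theorem exists_hamiltonianColoring [Nontrivial V] (hG : G.Connected) {w : V}
    (hw : G.detourCenter = {w}) (hord : G.HasDetourOrdering) :
    ∃ c : V → ℕ, G.IsHamiltonianColoring c ∧ ((Finset.univ.sup c : ℕ) : ℤ) =
      ((Fintype.card V : ℤ) - 1) * ((Fintype.card V : ℤ) - 1) - 2 * G.totalDetourLevel +
        G.detourXi := by
  obtain ⟨u, hu, h0, h1, hle⟩ := hord
  rw [detourOmega_eq_one hw] at hle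
  have hn1 : 1 < Fintype.card V := Fintype.one_lt_card
  let gap : ℕ → ℤ := fun t =>
    (Fintype.card V : ℤ) - 1 - G.detourLevel (u t) - G.detourLevel (u (t + 1))
  have hgap (t : ℕ) (ht : t + 1 < Fintype.card V) : 0 ≤ gap t := by
    have h := hle t (t + 1) (by omega) ht
    have hd := hG.detourDist_lt_card (u t) (u (t + 1))
    rw [Nat.Ico_succ_singleton, Finset.sum_singleton] at h
    push_cast at h
    ring_nf at h
    rw [add_comm 1 t] at h
    simp only [gap]
    omega
  let C : ℕ → ℤ := fun t => ∑ s ∈ Finset.range t, gap s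
  have hCmono (i j : ℕ) (hij : i ≤ j) (hj : j < Fintype.card V) : C i ≤ C j := by
    refine Finset.sum_le_sum_of_subset_of_nonneg (by simpa using hij) fun t ht _ => hgap t ?_
    rw [Finset.mem_range] at ht
    omega
  let f : V → ℕ := Function.invFunOn u (Set.Iio (Fintype.card V))
  have hfu (t : ℕ) (ht : t < Fintype.card V) : f (u t) = t := hu.invOn_invFunOn.1 ht
  let c : V → ℕ := fun x => (C (f x)).toNat
  have hc (t : ℕ) (ht : t < Fintype.card V) : (c (u t) : ℤ) = C t := by
    simp only [c]
    rw [hfu t ht, Int.toNat_of_nonneg]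
    exact hCmono 0 t (Nat.zero_le t) ht
  have key (i j : ℕ) (hij : i < j) (hj : j < Fintype.card V) :
      (Fintype.card V : ℤ) - 1 ≤ G.detourDist (u i) (u j) + (C j - C i) := by
    have h := hle i j hij hj
    have hC : C j - C i = ((j : ℤ) - i) * ((Fintype.card V : ℤ) - (1 : ℕ)) -
        ∑ t ∈ Finset.Ico i j, ((G.detourLevel (u t) : ℤ) + G.detourLevel (u (t + 1))) := by
      simp only [C]
      rw [← Finset.sum_Ico_eq_sub _ hij.le]
      rw [Finset.sum_congr rfl fun t _ => show gap t = ((Fintype.card V : ℤ) - (1 : ℕ)) -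
        (G.detourLevel (u t) + G.detourLevel (u (t + 1))) by simp only [gap]; push_cast; ring,
        Finset.sum_sub_distrib, Finset.sum_const, Nat.card_Ico, nsmul_eq_mul,
        Nat.cast_sub hij.le]
    linarith
  refine ⟨c, ?_, ?_⟩
  · intro x y hxy
    obtain ⟨i, hi, rfl⟩ := hu.surjOn (Set.mem_univ x)
    obtain ⟨j, hj, rfl⟩ := hu.surjOn (Set.mem_univ y)
    rw [hc i hi, hc j hj]
    rcases lt_trichotomy i j with hij | rfl | hij
    · have := key i j hij hj
      have := neg_abs_le (C i - C j)
      linarith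
    · exact absurd rfl hxy
    · have := key j i hij hi
      have := le_abs_self (C i - C j)
      rw [detourDist_comm]
      linarith
  · have hsup : Finset.univ.sup c = c (u (Fintype.card V - 1)) := by
      refine le_antisymm (Finset.sup_le fun x _ => ?_) (Finset.le_sup (f := c) (Finset.mem_univ _))
      obtain ⟨i, hi, rfl⟩ := hu.surjOn (Set.mem_univ x)
      replace hi : i < Fintype.card V := hi
      have := hCmono i (Fintype.card V - 1) (by omega) (by omega)
      rw [← hc i hi, ← hc _ (by omega)] at this
      exact_mod_cast this
    rw [hsup, hc _ (by omega), ← h1]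
    simp only [C, gap]
    rw [sum_range_detourGap hu (by omega), h0]
    push_cast
    ring

theorem hamiltonianChromaticNumber_eq [Nontrivial V] (hG : G.IsBlockGraph) {w : V}
    (hw : G.detourCenter = {w}) (hord : G.HasDetourOrdering) :
    (G.hamiltonianChromaticNumber : ℤ) =
      ((Fintype.card V : ℤ) - 1) * ((Fintype.card V : ℤ) - 1) - 2 * G.totalDetourLevel +
        G.detourXi := by
  obtain ⟨c, hc, hsup⟩ := exists_hamiltonianColoring hG.1 hw hord
  rw [← hsup, Nat.cast_inj]
  refine IsLeast.csInf_eq ⟨⟨c, hc, rfl⟩, ?_⟩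
  rintro m ⟨c', hc', rfl⟩
  have := le_hamiltonianColoring_sup hG hw hc'
  rw [← hsup] at this
  exact_mod_cast this

end HamiltonianColoring

/-! ### Concatenating the orderings of the parts. -/

section GlueOrdering

variable {ι : Type*} {V : ι → Type*} {w : ∀ i, V i} {G : ∀ i, SimpleGraph (V i)}

theorem nontrivial_glueVertex (i : ι) [Nontrivial (V i)] : Nontrivial (GlueVertex w) :=
  (glueMk_injective w i).nontrivial

open Classical in
/-- The order on the glued graph with the base point first and then the other vertices of the
individual graphs, one graph after the other, in the order given by `s`. -/
noncomputable def glueRank (w : ∀ i, V i) (s : ι → ℕ) (M : ℕ) (f : ∀ i, V i → ℕ) :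
    GlueVertex w → ℕ :=
  Quotient.lift (fun x : Σ i, V i => if x.2 = w x.1 then 0 else 1 + (s x.1 * M + f x.1 x.2)) (by
    rintro x y (rfl | ⟨hx, hy⟩)
    · rfl
    · simp [hx, hy])

variable {s : ι → ℕ} {M : ℕ} {f : ∀ i, V i → ℕ}

theorem glueRank_base (i : ι) : glueRank w s M f (glueMk w i (w i)) = 0 :=
  if_pos rfl

theorem glueRank_of_ne {i : ι} {a : V i} (ha : a ≠ w i) :
    glueRank w s M f (glueMk w i a) = 1 + (s i * M + f i a) :=
  if_neg ha

theorem glueRank_injective (hs : Function.Injective s) (hM : ∀ i a, f i a < M)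
    (hf : ∀ i, Function.Injective (f i)) : Function.Injective (glueRank w s M f) := by
  intro x y hxy
  obtain ⟨i, a, rfl⟩ := exists_eq_glueMk x
  obtain ⟨j, b, rfl⟩ := exists_eq_glueMk y
  by_cases ha : a = w i <;> by_cases hb : b = w j
  · rw [ha, hb, glueMk_base]
  · rw [ha, glueRank_base, glueRank_of_ne hb] at hxy
    omega
  · rw [hb, glueRank_base, glueRank_of_ne ha] at hxy
    omega
  · rw [glueRank_of_ne ha, glueRank_of_ne hb] at hxy
    -- Since `f i a < M`, division by `M` recovers the part.
    have hpos : 0 < M := (Nat.zero_le _).trans_lt (hM i a)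
    have hdiv := congrArg (· / M) (Nat.add_left_cancel hxy)
    simp only [Nat.mul_comm _ M, Nat.mul_add_div hpos, Nat.div_eq_of_lt (hM _ _), add_zero] at hdiv
    obtain rfl := hs hdiv
    rw [hf i (by omega : f i a = f i b)]

variable [Fintype ι] [∀ i, Fintype (V i)]

theorem card_le_card_glueVertex (i : ι) :
    Fintype.card (V i) ≤ Fintype.card (GlueVertex w) :=
  Fintype.card_le_of_injective _ (glueMk_injective w i)

theorem totalDetourLevel_glue (hG : ∀ i, (G i).Connected)
    (hc : ∀ i, (G i).detourCenter = {w i}) :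
    (glue G w).totalDetourLevel = ∑ i, (G i).totalDetourLevel := by
  unfold totalDetourLevel
  rw [sum_glueVertex]
  · exact Finset.sum_congr rfl fun i _ => Finset.sum_congr rfl fun a _ =>
      detourLevel_glueMk hG hc i a
  · intro i
    rw [detourLevel_eq (detourCenter_glue hG hc i), detourDist_self]

variable [∀ i, Nontrivial (V i)]

theorem isDetourRank_glueRank (hG : ∀ i, (G i).IsBlockGraph)
    (hc : ∀ i, (G i).detourCenter = {w i}) (hord : ∀ i, (G i).HasDetourOrdering)
    (hf : ∀ i, (G i).IsDetourRank (f i)) (hM : ∀ i a, f i a < M) (hs : Function.Injective s)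
    {i₀ : ι} (hi₀ : ∀ i, s i ≤ s i₀) (hxi : (G i₀).detourXi = (glue G w).detourXi) :
    (glue G w).IsDetourRank (glueRank w s M f) := by
  have hG' (i : ι) : (G i).Connected := (hG i).1
  have hfw (i : ι) (a : V i) : f i (w i) ≤ f i a := by
    obtain ⟨x, hx, hle⟩ := (hf i).first
    rw [detourLevel_eq (hc i), (hG' i).detourDist_eq_zero_iff] at hx
    exact hx ▸ hle a
  have hnonneg (z : GlueVertex w) :
      0 ≤ (Fintype.card (GlueVertex w) : ℤ) - 1 - 2 * (glue G w).detourLevel z := by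
    obtain ⟨i, a, rfl⟩ := exists_eq_glueMk z
    rw [detourLevel_glueMk hG' hc]
    have h1 := two_mul_detourLevel_lt_card (hG i) (hc i) (hord i) a
    have h2 := card_le_card_glueVertex (w := w) i
    omega
  have hlevel (i : ι) : (glue G w).detourLevel (glueMk w i (w i)) = 0 := by
    rw [detourLevel_eq (detourCenter_glue hG' hc i), detourDist_self]
  refine ⟨glueRank_injective hs hM fun i => (hf i).injective, ?_, ?_, ?_⟩
  · exact ⟨glueMk w i₀ (w i₀), hlevel i₀, fun y => by rw [glueRank_base]; exact Nat.zero_le _⟩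
  · obtain ⟨x, hx, hle⟩ := (hf i₀).last
    -- The base point has the least rank in its part; if it also had the greatest, the part would be
    -- one vertex.
    have hxw : x ≠ w i₀ := by
      rintro rfl
      obtain ⟨y, hy⟩ := exists_ne (w i₀)
      exact hy ((hf i₀).injective (le_antisymm (hle y) (hfw i₀ y)))
    refine ⟨glueMk w i₀ x, by rw [detourLevel_glueMk hG' hc, hx, hxi], fun y => ?_⟩
    obtain ⟨j, b, rfl⟩ := exists_eq_glueMk y
    by_cases hb : b = w j
    · rw [hb, glueRank_base]
      exact Nat.zero_le _
    rw [glueRank_of_ne hb, glueRank_of_ne hxw]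
    by_cases hj : j = i₀
    · subst hj
      have := hle b
      omega
    · have h1 : s j + 1 ≤ s i₀ := lt_of_le_of_ne (hi₀ j) fun h => hj (hs h)
      have h2 := Nat.mul_le_mul_right M h1
      have h3 := hM j b
      rw [Nat.add_mul] at h2
      omega
  · intro x y hxy
    -- This alone settles every pair with `D = L + L`: first vertex the base point, or vertices in
    -- different parts.
    have hsum := Finset.sum_nonneg (s := {z | glueRank w s M f x < glueRank w s M f z ∧
      glueRank w s M f z < glueRank w s M f y}) fun z _ => hnonneg z
    obtain ⟨i, a, rfl⟩ := exists_eq_glueMk x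
    obtain ⟨j, b, rfl⟩ := exists_eq_glueMk y
    have hb : b ≠ w j := by
      rintro rfl
      rw [glueRank_base] at hxy
      omega
    by_cases ha : a = w i
    · subst ha
      rw [hlevel i, detourDist_base_glueMk hG', detourLevel_glueMk hG' hc, detourLevel_eq (hc j)]
      push_cast
      linarith
    by_cases hij : i = j
    · subst hij
      rw [detourLevel_glueMk hG' hc, detourLevel_glueMk hG' hc, detourDist_glueMk_same hG']
      have hab : f i a < f i b := by
        rw [glueRank_of_ne ha, glueRank_of_ne hb] at hxy
        omega
      refine ((hf i).le a b hab).trans (add_le_add_right ?_ _)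
      calc ∑ z with f i a < f i z ∧ f i z < f i b,
            ((Fintype.card (V i) : ℤ) - 1 - 2 * (G i).detourLevel z)
          ≤ ∑ z with f i a < f i z ∧ f i z < f i b, ((Fintype.card (GlueVertex w) : ℤ) - 1 -
            2 * (glue G w).detourLevel (glueMk w i z)) := by
            refine Finset.sum_le_sum fun z _ => ?_
            rw [detourLevel_glueMk hG' hc]
            have := card_le_card_glueVertex (w := w) i
            omega
        _ = ∑ z ∈ Finset.map ⟨glueMk w i, glueMk_injective w i⟩
              {z | f i a < f i z ∧ f i z < f i b}, ((Fintype.card (GlueVertex w) : ℤ) - 1 -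
            2 * (glue G w).detourLevel z) := by
            rw [Finset.sum_map]
            rfl
        _ ≤ _ := by
            refine Finset.sum_le_sum_of_subset_of_nonneg ?_ fun z _ _ => hnonneg z
            intro z hz
            simp only [Finset.mem_map, Finset.mem_filter, Finset.mem_univ, true_and,
              Function.Embedding.coeFn_mk] at hz ⊢
            obtain ⟨v, hv, rfl⟩ := hz
            have hvw : v ≠ w i := by
              rintro rfl
              exact absurd (hfw i a) (not_le.mpr hv.1)
            rw [glueRank_of_ne ha, glueRank_of_ne hb, glueRank_of_ne hvw]
            omega
    · rw [detourLevel_glueMk hG' hc, detourLevel_glueMk hG' hc, detourDist_glueMk_of_ne hG' hij,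
        detourLevel_eq (hc i), detourLevel_eq (hc j)]
      push_cast
      linarith

theorem hasDetourOrdering_glue [Nonempty ι] (hG : ∀ i, (G i).IsBlockGraph)
    (hc : ∀ i, (G i).detourCenter = {w i}) (hord : ∀ i, (G i).HasDetourOrdering) :
    (glue G w).HasDetourOrdering := by
  classical
  obtain ⟨i₀, hi₀⟩ := (isLeast_detourXi_glue (fun i => (hG i).1) hc).1
  have := nontrivial_glueVertex (w := w) i₀
  rw [hasDetourOrdering_iff_exists_isDetourRank
    (detourOmega_eq_one (detourCenter_glue (fun i => (hG i).1) hc i₀))]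
  have h (i : ι) := (hasDetourOrdering_iff_exists_isDetourRank
    (detourOmega_eq_one (hc i))).mp (hord i)
  choose f hf using h
  let e := Fintype.equivFin ι
  -- `Fintype.card ι` exceeds every value of `e`, which puts the part with least `ξ` last.
  let s : ι → ℕ := fun i => if i = i₀ then Fintype.card ι else e i
  refine ⟨_, isDetourRank_glueRank (s := s) (M := 1 + ∑ i, ∑ a, f i a) hG hc hord hf ?_ ?_
    (i₀ := i₀) ?_ hi₀⟩
  · intro i a
    have h1 := Finset.single_le_sum (f := f i) (fun _ _ => Nat.zero_le _) (Finset.mem_univ a)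
    have h2 := Finset.single_le_sum (f := fun i => ∑ a, f i a) (fun _ _ => Nat.zero_le _)
      (Finset.mem_univ i)
    omega
  · intro i j hij
    simp only [s] at hij
    have hi := (e i).2
    have hj := (e j).2
    split_ifs at hij with h1 h2 h2
    · rw [h1, h2]
    · omega
    · omega
    · exact e.injective (Fin.ext hij)
  · intro i
    simp only [s, if_true]
    split_ifs
    · exact le_rfl
    · exact (e i).2.le

end GlueOrdering

/-- Applied to `a i = n_i - 1`, this is the source of the cross terms: the squares belong to the
individual `hc(G_i)`. -/
theorem _root_.Fin.sum_mul_sum_eq_sum_Ioi {k : ℕ} (a : Fin k → ℤ) :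
    (∑ i, a i) * ∑ i, a i = ∑ i, a i * a i + 2 * ∑ i, ∑ j ∈ Finset.Ioi i, a i * a j := by
  induction k with
  | zero => simp
  | succ k ih =>
    have h := ih fun i => a i.succ
    simp only [Fin.sum_univ_succ, Fin.sum_Ioi_zero, Fin.sum_Ioi_succ, ← Finset.mul_sum] at h ⊢
    linarith

end SimpleGraph

theorem theorem8 {k : ℕ} (hk : 1 ≤ k) {V : Fin k → Type*} [∀ i, Fintype (V i)]
    [∀ i, Nontrivial (V i)] (G : ∀ i, SimpleGraph (V i)) (w : ∀ i, V i)
    (hblock : ∀ i, (G i).IsBlockGraph)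
    (hcenter : ∀ i, (G i).detourCenter = {w i})
    (hord : ∀ i, (G i).HasDetourOrdering) :
    (SimpleGraph.glue G w).IsBlockGraph ∧
    (∀ i, (SimpleGraph.glue G w).detourCenter = {SimpleGraph.glueMk w i (w i)}) ∧
    IsLeast (Set.range fun i => (G i).detourXi) (SimpleGraph.glue G w).detourXi ∧
    (SimpleGraph.glue G w).HasDetourOrdering ∧
    ((SimpleGraph.glue G w).hamiltonianChromaticNumber : ℤ) =
      ((Fintype.card (SimpleGraph.GlueVertex w) : ℤ) - 1) *
          ((Fintype.card (SimpleGraph.GlueVertex w) : ℤ) - (SimpleGraph.glue G w).detourOmega)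
        - 2 * (SimpleGraph.glue G w).totalDetourLevel + (SimpleGraph.glue G w).detourXi ∧
    ((SimpleGraph.glue G w).hamiltonianChromaticNumber : ℤ) =
      ∑ i, (((G i).hamiltonianChromaticNumber : ℤ) - (G i).detourXi)
        + 2 * ∑ i, ∑ j ∈ Finset.Ioi i,
            ((Fintype.card (V i) : ℤ) - 1) * ((Fintype.card (V j) : ℤ) - 1)
        + (SimpleGraph.glue G w).detourXi := by
  have : Nonempty (Fin k) := ⟨⟨0, hk⟩⟩
  have i₀ : Fin k := ⟨0, hk⟩
  have hG (i : Fin k) : (G i).Connected := (hblock i).1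
  have hc := SimpleGraph.detourCenter_glue hG hcenter
  have hB := SimpleGraph.isBlockGraph_glue (w := w) hblock
  have hO := SimpleGraph.hasDetourOrdering_glue hblock hcenter hord
  have := SimpleGraph.nontrivial_glueVertex (w := w) i₀
  have hhc := SimpleGraph.hamiltonianChromaticNumber_eq hB (hc i₀) hO
  refine ⟨hB, hc, SimpleGraph.isLeast_detourXi_glue hG hcenter, hO, ?_, ?_⟩
  · rw [SimpleGraph.detourOmega_eq_one (hc i₀), hhc, Nat.cast_one]
  · rw [hhc, SimpleGraph.card_glueVertex_sub_one, Fin.sum_mul_sum_eq_sum_Ioi,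
      SimpleGraph.totalDetourLevel_glue hG hcenter]
    simp only [fun i => SimpleGraph.hamiltonianChromaticNumber_eq (hblock i) (hcenter i) (hord i),
      add_sub_cancel_right, Finset.sum_sub_distrib, ← Finset.mul_sum]
    push_cast
    ring
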